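/- Let $r\ge 1$ and $n\ge 1$ be integers. An $r$-permutation of $[n]=\{1,\dots,n\}$ is a rearrangement $a_1a_2\cdots a_{rn}$ of the multiset $\{1^r,2^r,\dots,n^r\}$ such that $a_j\le a_i$ whenever $i<j<k$ and $a_i=a_k$. The stack-sorting operator $S$ is defined recursively: $S(\emptyset)=\emptyset$, and if $m$ is the largest letter of a nonempty word $\pi$ and $\pi=\alpha_1\,m\,\alpha_2\,m\cdots m\,\alpha_k$, where no $\alpha_i$ contains $m$, then $S(\pi)=S(\alpha_1)S(\alpha_2)\cdots S(\alpha_k)\,m$. An $r$-permutation $\pi$ of $[n]$ is two-stack-sortable if $S(S(\pi))=12\cdots n$. **Theorem.** The number of two-stack-sortable $r$-permutations of $[n]$ is $$2(r+1)\,\frac{((2r+1)n)!}{n!\,(2rn+2)!}.$$ In particular (the case $r=1$, conjectured by West and proved by Zeilberger), the number of ordinary permutations $\pi$ of $[n]$ with $S(S(\pi))=12\cdots n$ is $\dfrac{2\,(3n)!}{(n+1)!\,(2n+1)!}$. -/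

import Mathlib

/-- The blocks obtained by cutting a list at the occurrences of one of its entries are strictly
shorter than the list. -/
theorem length_lt_of_mem_splitOn {w : List ℕ} {m : ℕ} (hm : m ∈ w) {u : List ℕ}
    (hu : u ∈ w.splitOn m) : u.length < w.length := by
  induction hk : w.length using Nat.strong_induction_on generalizing w with
  | _ k ih =>
    subst hk
    have key : ∀ v : List ℕ, v.length < w.length → u ∈ v.splitOn m → u.length < w.length := by
      intro v hv huv
      by_cases hmv : m ∈ v
      · exact (ih v.length hv hmv huv rfl).trans hv
      · rw [List.splitOn_eq_singleton hmv, List.mem_singleton] at huv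
        exact huv ▸ hv
    obtain ⟨s, t, rfl⟩ := List.append_of_mem hm
    rw [List.splitOn_append_cons_self, List.mem_append] at hu
    rcases hu with h | h
    · exact key s (by simp) h
    · exact key t (by simp; omega) h

/-- The stack-sorting operator on words. The empty word is sent to the empty word. A nonempty word
with largest letter `m` is cut at all occurrences of `m`, as `w = α₁ m α₂ m ⋯ m αₖ` with no `m` in
any `αᵢ`, and `S(w) = S(α₁) S(α₂) ⋯ S(αₖ) m`. For a word with distinct letters this is the
ordinary stack-sorting operator `S(α₁ m α₂) = S(α₁) S(α₂) m`. -/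
def stackSort (w : List ℕ) : List ℕ :=
  if h : w = [] then []
  else (w.splitOn (w.max h)).attach.flatMap (fun u => stackSort u.1) ++ [w.max h]
termination_by w.length
decreasing_by exact length_lt_of_mem_splitOn (List.max_mem h) u.2

@[simp] theorem stackSort_nil : stackSort [] = [] := by
  rw [stackSort, dif_pos rfl]

/-- The recursive equation of the stack-sorting operator. -/
theorem stackSort_of_ne_nil {w : List ℕ} (h : w ≠ []) :
    stackSort w = (w.splitOn (w.max h)).flatMap stackSort ++ [w.max h] := by
  rw [stackSort, dif_neg h]
  congr 1
  simp [List.flatMap_def]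

/-- `w` is an `r`-permutation of `[n]`: a rearrangement of the multiset `{1^r, 2^r, …, n^r}`
such that no letter larger than `a` stands between two occurrences of `a`. -/
structure IsRPermutation (r n : ℕ) (w : List ℕ) : Prop where
  coe_eq : (w : Multiset ℕ) = r • (Finset.Icc 1 n).val
  le_of_between : ∀ i j k : Fin w.length, i < j → j < k → w[i] = w[k] → w[j] ≤ w[i]

/-- The identity permutation `1 2 ⋯ n` of `[n]`, as a word. -/
def identityWord (n : ℕ) : List ℕ := List.range' 1 n

/-- `w` is a two-stack-sortable `r`-permutation of `[n]`: an `r`-permutation of `[n]` such that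
applying the stack-sorting operator twice gives the identity permutation of `[n]`. -/
def IsTwoStackSortable (r n : ℕ) (w : List ℕ) : Prop :=
  IsRPermutation r n w ∧ stackSort (stackSort w) = identityWord n

/-! The operator S sends an r-word to a word without repeated letters, so the count is the sum, over
the σ with S(σ) = 12⋯n, of the number of r-words w with S(w) = σ. Call a nonempty r-word a tree: it
consists of r copies of its largest letter separating r + 1 possibly empty r-words with disjoint
letters. Count more generally forests, that is, sequences of j trees whose images concatenate to σ;
their number is `wordPow (treeCount r) j σ`.

Write σ = α m β with m the largest letter. Since S(σ) = S(α) S(β) m is increasing, α and β are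
sortable words on consecutive intervals. The image of a tree ends in its largest letter, so the tree
whose image contains m has an image ending at m. Hence j + 1 trees over σ amount to q₁ trees over a
prefix of α, the r + 1 blocks over the rest of α, and q₂ trees over β, with q₁ + q₂ = j. If l blocks
are nonempty, they join the q₁ trees in a forest of q₁ + l trees over α, whence the factor `(r +
1).choose l` and the recurrence of `forestCount` (`sum_wordPow_treeCount`).

With t marking letters and u marking trees, this reads F = 1 + t u F · [u^{≥0}] (1 + u⁻¹)^{r+1} F,
and the coefficient of u is wanted. The equation has only one solution when X divides t
(`IsForestSequence.unique`), so it is enough to verify a guess: under t = y (1 - y)^{2r} and V (1 -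
y - yV) = u, take F = (1 - yV/(1 - y))^r / (1 - yV)^{r+1}. It works because t (1 + u)^{r+1} F + u^r
/ F is symmetric in the two roots V, hence a polynomial in u of degree at most r
(`functional_identity`, `exists_polynomial_power_sum`). The coefficient of u in F is y (1 - (r + 1)
y) / (1 - y)^2, and Lagrange inversion (`coeff_of_subst_eq`) gives the formula. -/

/-! ### Solving the functional equation in the parameter y -/

open PowerSeries in
/-- The Catalan-type series `V` with `V (1 - y - y V) = u`. -/
theorem exists_kernel_root {R : Type*} [CommRing R] (y b : R) (hb : (1 - y) * b = 1) :
    ∃ V : R⟦X⟧, constantCoeff V = 0 ∧ coeff 1 V = b ∧ V * (1 - C y - C y * V) = X := by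
  have hc : ∀ a : R, rescale a (catalanSeries.map (Nat.castRingHom R)) =
      1 + C a * X * rescale a (catalanSeries.map (Nat.castRingHom R)) ^ 2 := by
    intro a
    have h := congrArg (fun f => rescale a (PowerSeries.map (Nat.castRingHom R) f))
      catalanSeries_sq_mul_X_add_one
    simp only [map_add, map_mul, map_pow, map_X, map_one, rescale_X] at h
    linear_combination -h
  set G := rescale (y * b ^ 2) (catalanSeries.map (Nat.castRingHom R)) with hG
  have hG1 := hc (y * b ^ 2)
  rw [← hG] at hG1
  have hG0 : constantCoeff G = 1 := by
    rw [hG1]; simp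
  have hb' : (1 - C y) * C b = (1 : R⟦X⟧) := by
    rw [← map_one C, ← map_sub, ← map_mul, hb]
  -- Dividing the equation by 1 - y gives V = b u + y b V²; with V = b u G this is the Catalan
  -- equation G = 1 + (y b²) u G².
  refine ⟨C b * X * G, by simp, ?_, ?_⟩
  · rw [mul_assoc, coeff_C_mul, show (1 : ℕ) = 0 + 1 from rfl, coeff_succ_X_mul]
    simp [hG0]
  · simp only [map_mul, map_pow] at hG1
    linear_combination (X * G) * hb' + X * hG1

/-- The two roots V, V' of the kernel satisfy y V' = 1 - y - y V. Exchanging them swaps V (1 - y V)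
with (1 - y - y V)(1 + V), and 1 - y V with 1 - (1 - y - y V), so the right-hand side is symmetric.
-/
theorem functional_identity {A : Type*} [CommRing A] (r : ℕ) {y b V u i j : A}
    (hb : (1 - y) * b = 1) (hV : V * (1 - y - y * V) = u) (hi : (1 - y * V) * i = 1)
    (hj : (1 - y * V * b) * j = 1) :
    y * (1 - y) ^ (2 * r) * ((1 + u) ^ (r + 1) * ((1 - y * V * b) ^ r * i ^ (r + 1))) +
      u ^ r * ((1 - y * V) ^ (r + 1) * j ^ r) =
    (1 - y) ^ r * (((1 - y - y * V) * (1 + V)) ^ r * (1 - (1 - y - y * V)) +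
      (V * (1 - y * V)) ^ r * (1 - y * V)) := by
  have h1 : 1 + u = (1 - y * V) * (1 + V) := by rw [← hV]; ring
  have h2 : (1 - y) * (1 - y * V * b) = 1 - y - y * V := by linear_combination (-y * V) * hb
  have h3 : (1 - y - y * V) * j = 1 - y := by
    rw [← h2]; linear_combination (1 - y) * hj
  have e1 : (1 + u) ^ (r + 1) * ((1 - y * V * b) ^ r * i ^ (r + 1)) =
      (1 + V) ^ (r + 1) * (1 - y * V * b) ^ r := by
    calc _ = ((1 - y * V) * i) ^ (r + 1) * ((1 + V) ^ (r + 1) * (1 - y * V * b) ^ r) := by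
          rw [h1, mul_pow, mul_pow]; ring
      _ = _ := by rw [hi]; ring
  have e2 : y * (1 - y) ^ (2 * r) * ((1 + V) ^ (r + 1) * (1 - y * V * b) ^ r) =
      (1 - y) ^ r * (((1 - y) * (1 - y * V * b)) ^ r * (1 + V) ^ r * (y * (1 + V))) := by
    rw [mul_pow]; ring
  have e3 : u ^ r * ((1 - y * V) ^ (r + 1) * j ^ r) =
      V ^ r * (1 - y * V) ^ (r + 1) * ((1 - y - y * V) * j) ^ r := by
    rw [← hV, mul_pow, mul_pow]; ring
  rw [e1, e2, e3, h2, h3, mul_pow, mul_pow]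
  ring

/-- The power sums appearing in `functional_identity` satisfy a two-term recurrence over the
polynomials in `u`. -/
theorem power_sum_recurrence {A : Type*} [CommRing A] {y V u : A}
    (hV : V * (1 - y - y * V) = u) (k : ℕ) :
    ((1 - y - y * V) * (1 + V)) ^ (k + 2) * (1 - (1 - y - y * V)) +
      (V * (1 - y * V)) ^ (k + 2) * (1 - y * V) =
    (1 - y + 2 * u) * (((1 - y - y * V) * (1 + V)) ^ (k + 1) * (1 - (1 - y - y * V)) +
      (V * (1 - y * V)) ^ (k + 1) * (1 - y * V)) -
    u * (1 + u) * (((1 - y - y * V) * (1 + V)) ^ k * (1 - (1 - y - y * V)) +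
      (V * (1 - y * V)) ^ k * (1 - y * V)) := by
  have hs : 1 - y + 2 * u = (1 - y - y * V) * (1 + V) + V * (1 - y * V) := by
    rw [← hV]; ring
  have hp : u * (1 + u) = (1 - y - y * V) * (1 + V) * (V * (1 - y * V)) := by
    rw [← hV]; ring
  rw [hs, hp]
  ring

open PowerSeries in
theorem exists_polynomial_power_sum {R : Type*} [CommRing R] (y : R) (V : R⟦X⟧)
    (hV : V * (1 - C y - C y * V) = X) (k : ℕ) :
    ∃ P : Polynomial R, P.natDegree ≤ k ∧
      ((1 - C y - C y * V) * (1 + V)) ^ k * (1 - (1 - C y - C y * V)) +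
        (V * (1 - C y * V)) ^ k * (1 - C y * V) = (P : R⟦X⟧) := by
  induction k using Nat.strong_induction_on with
  | _ k ih =>
    match k with
    | 0 =>
      refine ⟨Polynomial.C (1 + y), by simp, ?_⟩
      simp only [Polynomial.coe_C]
      simp only [pow_zero, map_add, map_one]
      ring
    | 1 =>
      refine ⟨Polynomial.C (1 + 3 * y) * Polynomial.X + Polynomial.C ((1 - y) * y),
        Polynomial.natDegree_linear_le, ?_⟩
      simp only [Polynomial.coe_C, Polynomial.coe_add, Polynomial.coe_mul, Polynomial.coe_X]
      simp only [pow_one, map_add, map_one, map_sub, map_mul, map_ofNat]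
      rw [← hV]
      ring
    | k + 2 =>
      obtain ⟨P, hP, eP⟩ := ih (k + 1) (by omega)
      obtain ⟨Q, hQ, eQ⟩ := ih k (by omega)
      refine ⟨(Polynomial.C 2 * Polynomial.X + Polynomial.C (1 - y)) * P -
        (Polynomial.X * (1 + Polynomial.X)) * Q, ?_, ?_⟩
      · refine (Polynomial.natDegree_sub_le _ _).trans (max_le ?_ ?_)
        · refine Polynomial.natDegree_mul_le.trans ?_
          have := Polynomial.natDegree_linear_le (a := (2 : R)) (b := 1 - y)
          omega
        · refine Polynomial.natDegree_mul_le.trans ?_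
          have : (Polynomial.X * (1 + Polynomial.X) : Polynomial R).natDegree ≤ 2 := by
            compute_degree
          omega
      · rw [power_sum_recurrence hV, eP, eQ]
        push_cast
        simp only [map_sub, map_one, map_ofNat]
        ring

open PowerSeries in
theorem coeff_one_add_X_pow_mul {R : Type*} [CommRing R] (F : R⟦X⟧) (r j : ℕ) :
    coeff (j + r) ((1 + X) ^ r * F) =
      ∑ l ∈ Finset.range (r + 1), (r.choose l : R) * coeff (j + l) F := by
  rw [add_comm (1 : R⟦X⟧) X, add_pow, Finset.sum_mul, map_sum]
  rw [← Finset.sum_range_reflect]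
  refine Finset.sum_congr rfl fun l hl => ?_
  have hl' : l ≤ r := by simpa [Nat.lt_succ_iff] using hl
  rw [one_pow, mul_one, show r + 1 - 1 - l = r - l by omega, Nat.choose_symm hl', mul_assoc,
    show j + r = (j + l) + (r - l) by omega, coeff_X_pow_mul, ← map_natCast (C (R := R)),
    coeff_C_mul]

open PowerSeries in
/-- A closed-form solution of the functional equation. -/
theorem exists_solution {R : Type*} [CommRing R] (r : ℕ) (y b : R) (hb : (1 - y) * b = 1) :
    ∃ F : ℕ → R, F 0 = 1 ∧ F 1 = y * (1 - (r + 1) * y) * b ^ 2 ∧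
      ∀ j, F (j + 1) = y * (1 - y) ^ (2 * r) * ∑ q ∈ Finset.HasAntidiagonal.antidiagonal j,
        (∑ l ∈ Finset.range (r + 2), ((r + 1).choose l : R) * F (q.1 + l)) * F q.2 := by
  obtain ⟨V, hV0, hV1, hV⟩ := exists_kernel_root y b hb
  have hCb : (1 - C y) * C b = (1 : R⟦X⟧) := by
    rw [← map_one C, ← map_sub, ← map_mul, hb]
  have hu : ∀ f : R⟦X⟧, constantCoeff f = 1 → ∃ g, f * g = 1 ∧ constantCoeff g = 1 := by
    intro f hf
    refine ⟨invOfUnit f 1, mul_invOfUnit f 1 (by simpa using hf), by simp⟩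
  obtain ⟨i, hi, hi0⟩ := hu (1 - C y * V) (by simp [hV0])
  obtain ⟨s, hs, hs0⟩ := hu (1 - C y * V * C b) (by simp [hV0])
  have key := functional_identity r hCb hV hi hs
  obtain ⟨P, hP, eP⟩ := exists_polynomial_power_sum y V hV r
  rw [eP] at key
  -- Here `i` and `s` are the inverses of 1 - yV and 1 - yVb, so that F and H are reciprocal.
  set F := (1 - C y * V * C b) ^ r * i ^ (r + 1) with hF
  set H := (1 - C y * V) ^ (r + 1) * s ^ r with hH
  have hFH : F * H = 1 := by
    calc F * H = ((1 - C y * V * C b) * s) ^ r * ((1 - C y * V) * i) ^ (r + 1) := by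
          rw [hF, hH, mul_pow, mul_pow]; ring
      _ = 1 := by rw [hs, hi]; simp
  have hF0 : constantCoeff F = 1 := by simp [hF, hV0, hi0]
  have hH0 : constantCoeff H = 1 := by simp [hH, hV0, hs0]
  -- In degree j + 1 + r the polynomial side of `key` vanishes, as its degree is at most r.
  have hcoef : ∀ j, y * (1 - y) ^ (2 * r) *
      ∑ l ∈ Finset.range (r + 2), ((r + 1).choose l : R) * coeff (j + l) F =
        - coeff (j + 1) H := by
    intro j
    have h := congrArg (coeff (j + 1 + r)) key
    rw [map_add, coeff_X_pow_mul, ← map_one C, ← map_sub, ← map_pow, ← map_pow,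
      ← map_mul, coeff_C_mul, coeff_C_mul, Polynomial.coeff_coe,
      Polynomial.coeff_eq_zero_of_natDegree_lt (by omega), mul_zero, map_one,
      show j + 1 + r = j + (r + 1) by omega, coeff_one_add_X_pow_mul] at h
    exact eq_neg_of_add_eq_zero_left h
  refine ⟨fun j => coeff j F, by simpa using hF0, ?_, fun j => ?_⟩
  · have h1 : ∀ (f g : R⟦X⟧), coeff 1 (f * g) =
        constantCoeff f * coeff 1 g + coeff 1 f * constantCoeff g := by
      intro f g
      rw [coeff_mul, Finset.Nat.antidiagonal_succ]
      simp
    have h2 : ∀ (f : R⟦X⟧) (n : ℕ), constantCoeff f = 1 → coeff 1 (f ^ n) = n * coeff 1 f := by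
      intro f n hf
      induction n with
      | zero => simp [coeff_one]
      | succ n ih => rw [pow_succ, h1, ih]; simp [hf]; ring
    have hi1 : coeff 1 i = y * b := by
      have := congrArg (coeff 1) hi
      rw [h1] at this
      simp [hV0, hi0, hV1, coeff_one] at this
      linear_combination this
    have hc1 : coeff 1 (1 - C y * V * C b) = - (y * b * b) := by
      rw [map_sub, mul_assoc, coeff_C_mul, coeff_mul_C]
      simp [hV1, coeff_one]
      ring
    change coeff 1 F = _
    rw [hF, h1, h2 _ _ hi0, h2 _ _ (by simp [hV0]), hi1, hc1]
    simp [hV0, hi0]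
    linear_combination (-(y * b * (r + 1))) * hb
  · change coeff (j + 1) F = y * (1 - y) ^ (2 * r) * ∑ q ∈ Finset.HasAntidiagonal.antidiagonal j,
      (∑ l ∈ Finset.range (r + 2), ((r + 1).choose l : R) * coeff (q.1 + l) F) * coeff q.2 F
    -- Since F H = 1, each coefficient F_{j+1} is minus the sum of H_{q₁+1} F_{q₂} over q₁ + q₂ = j,
    -- and `hcoef` rewrites the factor from H.
    have h := congrArg (coeff (j + 1)) hFH
    rw [mul_comm, coeff_mul, Finset.Nat.antidiagonal_succ, Finset.sum_cons, Finset.sum_map] at h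
    simp [hH0, coeff_one] at h
    rw [eq_neg_of_add_eq_zero_left h, Finset.mul_sum, ← Finset.sum_neg_distrib]
    refine Finset.sum_congr rfl fun q _ => ?_
    rw [← mul_assoc, hcoef]
    ring

/-! ### Uniqueness of the solution -/

/-- The coefficient form of the functional equation `F = 1 + t u F · [u^{≥0}] (1 + u⁻¹)^{r+1} F`. -/
def IsForestSequence {R : Type*} [CommSemiring R] (r : ℕ) (t : R) (F : ℕ → R) : Prop :=
  F 0 = 1 ∧ ∀ j, F (j + 1) = t * ∑ q ∈ Finset.HasAntidiagonal.antidiagonal j,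
    (∑ l ∈ Finset.range (r + 2), ((r + 1).choose l : R) * F (q.1 + l)) * F q.2

theorem IsForestSequence.map {R S : Type*} [CommSemiring R] [CommSemiring S] {r : ℕ} {t : R}
    {F : ℕ → R} (h : IsForestSequence r t F) (θ : R →+* S) :
    IsForestSequence r (θ t) (fun j => θ (F j)) := by
  refine ⟨by simp [h.1], fun j => ?_⟩
  simp only [h.2 j, map_mul, map_sum, map_natCast]

/-- The factor t in the recurrence gains one power of t at each application, uniformly in j. -/
theorem IsForestSequence.pow_dvd_sub {R : Type*} [CommRing R] {r : ℕ} {t : R} {F G : ℕ → R}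
    (hF : IsForestSequence r t F) (hG : IsForestSequence r t G) (m : ℕ) :
    ∀ j, t ^ m ∣ F j - G j := by
  induction m with
  | zero => simp
  | succ m ih =>
    rintro (_ | j)
    · simp [hF.1, hG.1]
    · rw [hF.2, hG.2, ← mul_sub, ← Finset.sum_sub_distrib, pow_succ']
      refine mul_dvd_mul_left t (Finset.dvd_sum fun q _ => ?_)
      have h1 : t ^ m ∣ (∑ l ∈ Finset.range (r + 2), ((r + 1).choose l : R) * F (q.1 + l)) -
          ∑ l ∈ Finset.range (r + 2), ((r + 1).choose l : R) * G (q.1 + l) := by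
        rw [← Finset.sum_sub_distrib]
        refine Finset.dvd_sum fun l _ => ?_
        rw [← mul_sub]
        exact Dvd.dvd.mul_left (ih _) _
      exact dvd_mul_sub_mul h1 (ih _)

open PowerSeries in
theorem IsForestSequence.unique {r : ℕ} {t : ℚ⟦X⟧} {F G : ℕ → ℚ⟦X⟧} (ht : X ∣ t)
    (hF : IsForestSequence r t F) (hG : IsForestSequence r t G) (j : ℕ) : F j = G j := by
  rw [← sub_eq_zero]
  ext m
  exact X_pow_dvd_iff.1 ((pow_dvd_pow_of_dvd ht (m + 1)).trans
    (hF.pow_dvd_sub hG (m + 1) j)) m (Nat.lt_succ_self m)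

/-! ### Lagrange inversion and the closed form -/

open PowerSeries in
theorem coeff_mk_one_pow (e k : ℕ) :
    coeff k ((PowerSeries.mk 1 : ℚ⟦X⟧) ^ (e + 1)) = ((e + k).choose e : ℚ) := by
  rw [mk_one_pow_eq_mk_choose_add, coeff_mk]

-- With T = y (1 - y)^s, the series is y^{m+1} T' / T^{m+1}. Its coefficient is thus the residue of
-- T' / T^{m+1}, which is 1 for m = 0 and 0 for m ≥ 1.
open PowerSeries in
theorem coeff_lagrange_kernel (s m : ℕ) :
    coeff m ((1 - ((s + 1 : ℕ) : ℚ⟦X⟧) * X) * (PowerSeries.mk 1 : ℚ⟦X⟧) ^ (s * m + 1)) =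
      if m = 0 then 1 else 0 := by
  rcases m with _ | m
  · simp
  · rw [sub_mul, one_mul, map_sub, coeff_mk_one_pow, mul_assoc, ← map_natCast (C (R := ℚ)),
      coeff_C_mul, coeff_succ_X_mul, coeff_mk_one_pow, if_neg (Nat.succ_ne_zero m)]
    have h1 : (s * (m + 1) + (m + 1)).choose (s * (m + 1)) =
        (s * (m + 1) + m + 1).choose (m + 1) := by
      rw [Nat.choose_symm_add]; rfl
    have h2 : (s * (m + 1) + m).choose (s * (m + 1)) = (s * (m + 1) + m).choose m :=
      Nat.choose_symm_add
    have h3 := Nat.add_one_mul_choose_eq (s * (m + 1) + m) m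
    rw [h1, h2]
    have h4 : ((s * (m + 1) + m + 1 : ℕ) : ℚ) * ((s * (m + 1) + m).choose m : ℕ) =
        ((s * (m + 1) + m + 1).choose (m + 1) : ℕ) * ((m + 1 : ℕ) : ℚ) := by exact_mod_cast h3
    have h5 : ((m : ℚ) + 1) ≠ 0 := by positivity
    apply mul_left_cancel₀ h5
    push_cast at h4 ⊢
    linear_combination -h4

open PowerSeries in
/-- Lagrange inversion for the substitution `t = y (1 - y) ^ s`. -/
theorem coeff_of_subst_eq (s : ℕ) {f h : ℚ⟦X⟧}
    (hf : f.subst (X * (1 - X) ^ s : ℚ⟦X⟧) = h) (n : ℕ) :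
    coeff n f = coeff n (h * ((1 - ((s + 1 : ℕ) : ℚ⟦X⟧) * X) * (PowerSeries.mk 1) ^ (s * n + 1))) := by
  set T : ℚ⟦X⟧ := X * (1 - X) ^ s with hT
  have hTs : HasSubst T := HasSubst.of_constantCoeff_zero' (by simp [hT])
  -- Only the terms of f up to degree n matter, as T^{n+1} is divisible by X^{n+1}; substitution
  -- then reduces to a finite sum.
  obtain ⟨g, hg⟩ : (X : ℚ⟦X⟧) ^ (n + 1) ∣ f - ∑ d ∈ Finset.range (n + 1), coeff d f • X ^ d := by
    rw [X_pow_dvd_iff]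
    intro m hm
    simp [coeff_X_pow, hm]
  have hb : (PowerSeries.mk 1 : ℚ⟦X⟧) * (1 - X) = 1 := mk_one_mul_one_sub_eq_one ℚ
  have hfs : h = (∑ d ∈ Finset.range (n + 1), coeff d f • T ^ d) + T ^ (n + 1) * g.subst T := by
    rw [← hf, ← coe_substAlgHom hTs]
    conv_lhs => rw [sub_eq_iff_eq_add'.1 hg, map_add, map_mul, map_sum]
    simp only [map_smul, map_pow, substAlgHom_X]
  rw [hfs, add_mul, map_add, Finset.sum_mul, map_sum]
  have hz : coeff n (T ^ (n + 1) * g.subst T *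
      ((1 - ((s + 1 : ℕ) : ℚ⟦X⟧) * X) * (PowerSeries.mk 1) ^ (s * n + 1))) = 0 := by
    have hd : X ^ (n + 1) ∣ T ^ (n + 1) * g.subst T *
        ((1 - ((s + 1 : ℕ) : ℚ⟦X⟧) * X) * (PowerSeries.mk 1) ^ (s * n + 1)) := by
      rw [hT, mul_pow, mul_assoc, mul_assoc]
      exact dvd_mul_right _ _
    exact X_pow_dvd_iff.1 hd n (Nat.lt_succ_self n)
  have hterm : ∀ d ∈ Finset.range (n + 1), coeff n (coeff d f • T ^ d *
      ((1 - ((s + 1 : ℕ) : ℚ⟦X⟧) * X) * (PowerSeries.mk 1) ^ (s * n + 1))) =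
      coeff d f * if n - d = 0 then 1 else 0 := by
    intro d hd
    obtain ⟨k, rfl⟩ : ∃ k, n = k + d := ⟨n - d, by have := Finset.mem_range.1 hd; omega⟩
    rw [smul_mul_assoc, coeff_smul, Nat.add_sub_cancel, ← coeff_lagrange_kernel s k,
      ← coeff_X_pow_mul _ d k, smul_eq_mul]
    congr 2
    calc T ^ d * ((1 - ((s + 1 : ℕ) : ℚ⟦X⟧) * X) * (PowerSeries.mk 1) ^ (s * (k + d) + 1))
        = (PowerSeries.mk 1 * (1 - X)) ^ (s * d) * (X ^ d * ((1 - ((s + 1 : ℕ) : ℚ⟦X⟧) * X) *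
          (PowerSeries.mk 1) ^ (s * k + 1))) := by
          rw [hT, mul_pow, mul_pow, ← pow_mul]; ring
      _ = _ := by rw [hb, one_pow, one_mul]
  rw [hz, add_zero, Finset.sum_congr rfl hterm, Finset.sum_eq_single_of_mem n (by simp)]
  · simp
  · intro d hd hdn
    rw [if_neg (by have := Finset.mem_range.1 hd; omega), mul_zero]

open PowerSeries in
theorem closed_form (r n : ℕ) (hn : 1 ≤ n) :
    coeff n (X * (1 - ((r : ℚ⟦X⟧) + 1) * X) * (PowerSeries.mk 1) ^ 2 *
      ((1 - ((2 * r + 1 : ℕ) : ℚ⟦X⟧) * X) * (PowerSeries.mk 1 : ℚ⟦X⟧) ^ (2 * r * n + 1))) =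
    2 * ((r : ℚ) + 1) * (((2 * r + 1) * n).factorial : ℚ) /
      ((n.factorial : ℚ) * ((2 * r * n + 2).factorial : ℚ)) := by
  obtain ⟨k, rfl⟩ : ∃ k, n = k + 1 := ⟨n - 1, by omega⟩
  set e := 2 * r * (k + 1) + 2 with he
  have h1 : X * (1 - ((r : ℚ⟦X⟧) + 1) * X) * (PowerSeries.mk 1) ^ 2 *
      ((1 - ((2 * r + 1 : ℕ) : ℚ⟦X⟧) * X) * (PowerSeries.mk 1 : ℚ⟦X⟧) ^ (2 * r * (k + 1) + 1)) =
      X * ((PowerSeries.mk 1 : ℚ⟦X⟧) ^ (e + 1) - C (3 * (r : ℚ) + 2) *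
        (X * (PowerSeries.mk 1 : ℚ⟦X⟧) ^ (e + 1)) + C (((r : ℚ) + 1) * (2 * r + 1)) *
        (X * (X * (PowerSeries.mk 1 : ℚ⟦X⟧) ^ (e + 1)))) := by
    simp only [map_add, map_mul, map_natCast, map_ofNat, map_one]
    push_cast
    rw [he]
    ring
  rw [h1, coeff_succ_X_mul, map_add, map_sub, coeff_C_mul, coeff_C_mul, coeff_mk_one_pow]
  have hch : ∀ a : ℕ, ((e + a).choose e : ℚ) = (e + a).factorial / (e.factorial * a.factorial) :=
    fun a => Nat.cast_add_choose ℚ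
  have hef : (e.factorial : ℚ) ≠ 0 := by positivity
  have hek : (e : ℚ) = 2 * r * (k + 1) + 2 := by rw [he]; push_cast; ring
  -- For k = 0 and k = 1, respectively two and one of the three binomial terms are absent.
  rcases k with _ | _ | k
  · simp only [zero_add] at he hek ⊢
    rw [hch, coeff_zero_X_mul, coeff_zero_X_mul, show (2 * r + 1) * 1 = 2 * r + 1 by ring,
      show e = 2 * r + 1 + 1 by omega]
    simp only [Nat.factorial_succ, Nat.factorial_zero]
    have := Nat.factorial_pos (2 * r)
    push_cast
    field_simp
    ring
  · rw [coeff_succ_X_mul, coeff_succ_X_mul, coeff_zero_X_mul, coeff_mk_one_pow,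
      hch, hch, show (2 * r + 1) * (0 + 1 + 1) = e by rw [he]; ring]
    simp only [Nat.factorial_succ, Nat.factorial_zero, zero_add, add_zero]
    push_cast at hek ⊢
    field_simp
    rw [hek]
    ring
  · rw [coeff_succ_X_mul, coeff_succ_X_mul, coeff_succ_X_mul, coeff_mk_one_pow, coeff_mk_one_pow,
      hch, hch, hch, show (2 * r + 1) * (k + 1 + 1 + 1) = e + k + 1 by rw [he]; ring,
      show e + (k + 1 + 1) = e + k + 1 + 1 by ring, show e + (k + 1) = e + k + 1 by ring]
    simp only [Nat.factorial_succ]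
    have := Nat.factorial_pos k
    have := Nat.factorial_pos (e + k)
    push_cast at hek ⊢
    field_simp
    rw [hek]
    ring

/-! ### Forest numbers and their generating function -/

open Finset.HasAntidiagonal in
/-- The number of forests with `j` trees and `n` vertices, given by its recurrence. -/
def forestCount (r : ℕ) : ℕ → ℕ → ℕ
  | 0, j => if j = 0 then 1 else 0
  | _ + 1, 0 => 0
  | n + 1, j + 1 => ∑ p ∈ (antidiagonal n).attach, ∑ q ∈ antidiagonal j,
      (∑ l ∈ Finset.range (r + 2), (r + 1).choose l * forestCount r p.1.1 (q.1 + l)) *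
        forestCount r p.1.2 q.2
termination_by n => n
decreasing_by
  · have := Finset.HasAntidiagonal.mem_antidiagonal.1 p.2; omega
  · have := Finset.HasAntidiagonal.mem_antidiagonal.1 p.2; omega

open Finset.HasAntidiagonal in
theorem forestCount_succ_succ (r n j : ℕ) : forestCount r (n + 1) (j + 1) =
    ∑ p ∈ antidiagonal n, ∑ q ∈ antidiagonal j,
      (∑ l ∈ Finset.range (r + 2), (r + 1).choose l * forestCount r p.1 (q.1 + l)) *
        forestCount r p.2 q.2 := by
  rw [forestCount, ← Finset.sum_attach (antidiagonal n)]

open PowerSeries in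
theorem isForestSequence_forestCount (r : ℕ) : IsForestSequence r (X : ℚ⟦X⟧)
    (fun j => PowerSeries.mk fun n => (forestCount r n j : ℚ)) := by
  refine ⟨?_, fun j => ?_⟩
  · ext n
    cases n <;> simp [forestCount, coeff_one]
  · ext n
    cases n with
    | zero => simp [forestCount]
    | succ n =>
      rw [coeff_succ_X_mul, map_sum, coeff_mk, forestCount_succ_succ, Finset.sum_comm]
      push_cast
      refine Finset.sum_congr rfl fun q _ => ?_
      rw [coeff_mul]
      refine Finset.sum_congr rfl fun p _ => ?_
      rw [map_sum, coeff_mk]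
      congr 1
      refine Finset.sum_congr rfl fun l _ => ?_
      rw [← map_natCast (C (R := ℚ)), coeff_C_mul, coeff_mk]

open PowerSeries in
theorem forestCount_one (r n : ℕ) (hn : 1 ≤ n) : (forestCount r n 1 : ℚ) =
    2 * ((r : ℚ) + 1) * (((2 * r + 1) * n).factorial : ℚ) /
      ((n.factorial : ℚ) * ((2 * r * n + 2).factorial : ℚ)) := by
  have hTs : HasSubst (X * (1 - X) ^ (2 * r) : ℚ⟦X⟧) :=
    HasSubst.of_constantCoeff_zero' (by simp)
  have h1 := (isForestSequence_forestCount r).map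
    (substAlgHom (R := ℚ) hTs : ℚ⟦X⟧ →+* ℚ⟦X⟧)
  obtain ⟨F, hF0, hF1, hF⟩ := exists_solution r (X : ℚ⟦X⟧) (PowerSeries.mk 1)
    (by rw [mul_comm]; exact mk_one_mul_one_sub_eq_one ℚ)
  have hX : (substAlgHom (R := ℚ) hTs : ℚ⟦X⟧ →+* ℚ⟦X⟧) X = X * (1 - X) ^ (2 * r) :=
    substAlgHom_X hTs
  rw [hX] at h1
  -- The forest series at t = y (1 - y)^{2r} and the explicit solution obey the same recurrence;
  -- index 1 is the count of single trees.
  have h2 := h1.unique (dvd_mul_right _ _) ⟨hF0, hF⟩ 1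
  rw [hF1] at h2
  have h3 := coeff_of_subst_eq (2 * r)
    (f := PowerSeries.mk fun n => (forestCount r n 1 : ℚ)) (h := X * (1 - ((r : ℚ⟦X⟧) + 1) * X) * (PowerSeries.mk 1) ^ 2)
    (by rw [← coe_substAlgHom hTs]; exact h2) n
  rw [coeff_mk] at h3
  rw [h3]
  exact closed_form r n hn

/-! ### Convolution of functions on words -/

/-- Convolution of functions on words: `f * g` sums `f σ' * g σ''` over all `σ = σ' σ''`. -/
def wordConv {K : Type*} [CommSemiring K] (f g : List ℕ → K) : List ℕ → K
  | [] => f [] * g []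
  | x :: σ => f [] * g (x :: σ) + wordConv (fun τ => f (x :: τ)) g σ

section wordConv
variable {K : Type*} [CommSemiring K]

theorem wordConv_congr_left {f f' : List ℕ → K} (g : List ℕ → K) {σ : List ℕ}
    (h : ∀ τ, τ <+: σ → f τ = f' τ) : wordConv f g σ = wordConv f' g σ := by
  induction σ generalizing f f' with
  | nil => simp [wordConv, h]
  | cons x σ ih =>
    rw [wordConv, wordConv, h [] (by simp), ih fun τ hτ => h _ (by simpa using hτ)]

theorem wordConv_congr_right (f : List ℕ → K) {g g' : List ℕ → K} {σ : List ℕ}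
    (h : ∀ τ, τ <:+ σ → g τ = g' τ) : wordConv f g σ = wordConv f g' σ := by
  induction σ generalizing f with
  | nil => simp [wordConv, h]
  | cons x σ ih =>
    rw [wordConv, wordConv, h _ (List.suffix_refl _),
      ih _ fun τ hτ => h _ (hτ.trans (List.suffix_cons _ _))]

theorem wordConv_add_left (f f' g : List ℕ → K) (σ : List ℕ) :
    wordConv (fun τ => f τ + f' τ) g σ = wordConv f g σ + wordConv f' g σ := by
  induction σ generalizing f f' with
  | nil => simp [wordConv, add_mul]
  | cons x σ ih => simp only [wordConv, ih]; ring

theorem wordConv_mul_left (a : K) (f g : List ℕ → K) (σ : List ℕ) :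
    wordConv (fun τ => a * f τ) g σ = a * wordConv f g σ := by
  induction σ generalizing f with
  | nil => simp [wordConv, mul_assoc]
  | cons x σ ih => simp only [wordConv, ih]; ring

theorem wordConv_zero_left (g : List ℕ → K) (σ : List ℕ) :
    wordConv (fun _ => 0) g σ = 0 := by
  simpa using wordConv_mul_left 0 (fun _ => 0) g σ

theorem wordConv_mul_right (a : K) (f g : List ℕ → K) (σ : List ℕ) :
    wordConv f (fun τ => a * g τ) σ = a * wordConv f g σ := by
  induction σ generalizing f with
  | nil => simp [wordConv]; ring
  | cons x σ ih => simp only [wordConv, ih]; ring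

theorem wordConv_sum_right {ι : Type*} (s : Finset ι) (f : List ℕ → K) (g : ι → List ℕ → K)
    (σ : List ℕ) : wordConv f (fun τ => ∑ i ∈ s, g i τ) σ = ∑ i ∈ s, wordConv f (g i) σ := by
  induction σ generalizing f with
  | nil => simp [wordConv, Finset.mul_sum]
  | cons x σ ih => simp only [wordConv, ih, Finset.mul_sum, Finset.sum_add_distrib]

theorem wordConv_assoc (f g h : List ℕ → K) (σ : List ℕ) :
    wordConv (wordConv f g) h σ = wordConv f (wordConv g h) σ := by
  induction σ generalizing f with
  | nil => simp [wordConv, mul_assoc]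
  | cons x σ ih =>
    simp only [wordConv, wordConv_add_left, wordConv_mul_left, ih]
    ring

theorem wordConv_append_cons (f g : List ℕ → K) (α β : List ℕ) (m : ℕ) :
    wordConv f g (α ++ m :: β) = wordConv f (fun τ => g (τ ++ m :: β)) α +
      wordConv (fun τ => f (α ++ m :: τ)) g β := by
  induction α generalizing f with
  | nil => simp [wordConv]
  | cons x α ih => simp only [List.cons_append, wordConv, ih, add_assoc]

/-- Convolution powers. -/
def wordPow (f : List ℕ → K) : ℕ → List ℕ → K
  | 0 => fun σ => if σ = [] then 1 else 0
  | k + 1 => wordConv f (wordPow f k)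

theorem wordPow_succ (f : List ℕ → K) (k : ℕ) (σ : List ℕ) :
    wordPow f (k + 1) σ = wordConv f (wordPow f k) σ := rfl

theorem wordConv_wordPow_zero (f g : List ℕ → K) (σ : List ℕ) :
    wordConv f (wordPow g 0) σ = f σ := by
  induction σ generalizing f with
  | nil => simp [wordConv, wordPow]
  | cons x σ ih => simp [wordConv, ih]; simp [wordPow]

theorem wordPow_zero_wordConv (f g : List ℕ → K) (σ : List ℕ) :
    wordConv (wordPow f 0) g σ = g σ := by
  cases σ with
  | nil => simp [wordConv, wordPow]
  | cons x σ => simp [wordConv, wordPow, wordConv_zero_left]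

theorem wordPow_add (f : List ℕ → K) (i k : ℕ) (σ : List ℕ) :
    wordConv (wordPow f i) (wordPow f k) σ = wordPow f (i + k) σ := by
  induction i generalizing σ with
  | zero => rw [zero_add, wordPow_zero_wordConv]
  | succ i ih =>
    rw [Nat.succ_add, wordPow, wordPow, wordConv_assoc]
    exact wordConv_congr_right f fun τ _ => ih τ

theorem wordPow_one (f : List ℕ → K) (σ : List ℕ) : wordPow f 1 σ = f σ :=
  wordConv_wordPow_zero f f σ

/-- Powers of `1 + f`. -/
theorem wordPow_one_add (f : List ℕ → K) (k : ℕ) (σ : List ℕ) :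
    wordPow (fun τ => wordPow f 0 τ + f τ) k σ =
      ∑ i ∈ Finset.range (k + 1), (k.choose i : K) * wordPow f i σ := by
  induction k generalizing σ with
  | zero => simp [wordPow]
  | succ k ih =>
    have h := Finset.sum_range_succ (fun i => (k.choose i : K) * wordPow f i σ) (k + 1)
    rw [Nat.choose_succ_self, Nat.cast_zero, zero_mul, add_zero, Finset.sum_range_succ'] at h
    rw [wordPow_succ, wordConv_add_left, wordPow_zero_wordConv, ih,
      wordConv_congr_right f fun τ _ => ih τ, wordConv_sum_right, Finset.sum_range_succ' _ (k + 1),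
      ← h]
    simp only [wordConv_mul_right, Nat.choose_succ_succ, Nat.cast_add, add_mul,
      Finset.sum_add_distrib, Nat.choose_zero_right, wordPow_succ]
    ring

/-- If `f` vanishes on words having a last letter smaller than some other letter `m`,
then the convolution powers of `f` factor at a letter exceeding everything to its right. -/
theorem wordPow_append_cons {f : List ℕ → K} {β : List ℕ} {m : ℕ}
    (hf : ∀ α τ, τ ≠ [] → τ <+: β → f (α ++ m :: τ) = 0) (j : ℕ) (α : List ℕ) :
    wordPow f (j + 1) (α ++ m :: β) = ∑ q ∈ Finset.HasAntidiagonal.antidiagonal j,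
      wordConv (wordPow f q.1) (fun τ => f (τ ++ [m])) α * wordPow f q.2 β := by
  -- A factor containing m must stop at m, so only the cut just after m survives.
  have h2 : ∀ (α : List ℕ) (g : List ℕ → K),
      wordConv (fun τ => f (α ++ m :: τ)) g β = f (α ++ [m]) * g β := by
    intro α g
    cases β with
    | nil => simp [wordConv]
    | cons x β =>
      rw [wordConv, wordConv_congr_left (f' := fun _ => 0), wordConv_zero_left, add_zero]
      intro τ hτ
      exact hf α (x :: τ) (by simp) (by simpa using hτ)
  induction j generalizing α with
  | zero =>
    rw [wordPow, wordConv_append_cons, h2]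
    have : (fun τ => wordPow f 0 (τ ++ m :: β)) = fun _ => (0 : K) := by
      funext τ
      simp [wordPow]
    rw [this, show (fun _ : List ℕ => (0 : K)) = fun τ => 0 * (0 : K) by simp, wordConv_mul_right]
    simp [wordPow_zero_wordConv]
  | succ j ih =>
    -- Either m lies in the first factor, which is the term q.1 = 0, or in a later one, which is the
    -- inductive case.
    rw [wordPow, wordConv_append_cons, h2, wordConv_congr_right f fun τ _ => ih τ,
      wordConv_sum_right, Finset.Nat.antidiagonal_succ, Finset.sum_cons, Finset.sum_map,
      wordPow_zero_wordConv, add_comm]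
    congr 1
    refine Finset.sum_congr rfl fun q _ => ?_
    rw [show (fun τ => wordConv (wordPow f q.1) (fun τ => f (τ ++ [m])) τ * wordPow f q.2 β) =
      fun τ => wordPow f q.2 β * wordConv (wordPow f q.1) (fun τ => f (τ ++ [m])) τ from
      funext fun _ => mul_comm _ _, wordConv_mul_right, mul_comm, ← wordConv_assoc]
    rfl

end wordConv

/-! ### Block decomposition of r-words -/

theorem mem_intercalate_singleton {m x : ℕ} {L : List (List ℕ)} :
    x ∈ [m].intercalate L → x = m ∨ ∃ u ∈ L, x ∈ u := by
  induction L with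
  | nil => simp
  | cons u L ih =>
    rcases L with _ | ⟨v, L⟩
    · simpa using Or.inr
    · rw [List.intercalate_cons_cons]
      simp only [List.mem_append, List.mem_singleton]
      rintro ((h | h) | h)
      · exact Or.inr ⟨u, by simp, h⟩
      · exact Or.inl h
      · rcases ih h with h | ⟨w, hw, hx⟩
        · exact Or.inl h
        · exact Or.inr ⟨w, List.mem_cons_of_mem _ hw, hx⟩

theorem mem_intercalate_of_mem {m x : ℕ} {L : List (List ℕ)} {u : List ℕ} (hu : u ∈ L)
    (hx : x ∈ u) : x ∈ [m].intercalate L := by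
  induction L with
  | nil => simp at hu
  | cons v L ih =>
    rcases L with _ | ⟨v', L⟩
    · simp_all
    · rw [List.intercalate_cons_cons]
      rcases List.mem_cons.1 hu with rfl | hu
      · simp [hx]
      · simp [ih hu]

theorem mem_stackSort {x : ℕ} {w : List ℕ} : x ∈ stackSort w ↔ x ∈ w := by
  induction hk : w.length using Nat.strong_induction_on generalizing w with
  | _ k ih =>
    subst hk
    by_cases h : w = []
    · simp [h]
    · rw [stackSort_of_ne_nil h, List.mem_append, List.mem_flatMap, List.mem_singleton]
      constructor
      · rintro (⟨u, hu, hx⟩ | rfl)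
        · have hx' := (ih _ (length_lt_of_mem_splitOn (List.max_mem h) hu) rfl).1 hx
          rw [← List.intercalate_splitOn (w.max h) (xs := w)]
          exact mem_intercalate_of_mem hu hx'
        · exact List.max_mem h
      · intro hx
        rw [← List.intercalate_splitOn (w.max h) (xs := w)] at hx
        rcases mem_intercalate_singleton hx with hx | ⟨u, hu, hx⟩
        · exact Or.inr hx
        · exact Or.inl ⟨u, hu, (ih _ (length_lt_of_mem_splitOn (List.max_mem h) hu) rfl).2 hx⟩

theorem stackSort_eq_nil {w : List ℕ} : stackSort w = [] ↔ w = [] := by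
  simp only [List.eq_nil_iff_forall_not_mem, mem_stackSort]

theorem list_max_eq {w : List ℕ} {m : ℕ} (h : w ≠ []) (hm : m ∈ w) (hle : ∀ x ∈ w, x ≤ m) :
    w.max h = m :=
  le_antisymm (hle _ (List.max_mem h)) (List.le_max_of_mem hm)

theorem stackSort_intercalate {m : ℕ} {L : List (List ℕ)} (hL : 2 ≤ L.length)
    (hlt : ∀ u ∈ L, ∀ x ∈ u, x < m) :
    stackSort ([m].intercalate L) = L.flatMap stackSort ++ [m] := by
  have hm : m ∈ [m].intercalate L := by
    rcases L with _ | ⟨u, _ | ⟨v, L⟩⟩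
    · simp at hL
    · simp at hL
    · rw [List.intercalate_cons_cons]; simp
  have h0 : [m].intercalate L ≠ [] := List.ne_nil_of_mem hm
  have hmax : ([m].intercalate L).max h0 = m := by
    refine list_max_eq h0 hm fun x hx => ?_
    rcases mem_intercalate_singleton hx with rfl | ⟨u, hu, hx⟩
    · exact le_rfl
    · exact (hlt u hu x hx).le
  rw [stackSort_of_ne_nil h0, hmax, List.splitOn_intercalate m
    (fun u hu hx => (hlt u hu m hx).false) (by rintro rfl; simp at hL)]

/-- No letter larger than `a` stands between two occurrences of `a`. -/
def NestedWord (w : List ℕ) : Prop := ∀ a b, [a, b, a].Sublist w → b ≤ a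

theorem NestedWord.sublist {u w : List ℕ} (hw : NestedWord w) (h : u.Sublist w) : NestedWord u :=
  fun a b hab => hw a b (hab.trans h)

/-- A letter on both sides of m would enclose the larger m. This is a cut at the first m: later
copies are allowed in `v`. -/
theorem nestedWord_append_cons {u v : List ℕ} {m : ℕ} (hu : ∀ x ∈ u, x < m)
    (hv : ∀ x ∈ v, x ≤ m) :
    NestedWord (u ++ m :: v) ↔ NestedWord u ∧ NestedWord v ∧ u.Disjoint v := by
  constructor
  · intro h
    refine ⟨h.sublist (List.sublist_append_left _ _),
      h.sublist ((List.sublist_cons_self _ _).trans (List.sublist_append_right _ _)), ?_⟩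
    intro x hxu hxv
    have : ([x] ++ m :: [x]).Sublist (u ++ m :: v) :=
      (List.singleton_sublist.2 hxu).append ((List.singleton_sublist.2 hxv).cons_cons m)
    exact absurd (hu x hxu) (not_lt.2 (h x m this))
  · rintro ⟨h1, h2, h3⟩ a b hab
    have key : a ∈ u → a ∈ m :: v → b ≤ a := by
      intro ha ha'
      rcases List.mem_cons.1 ha' with rfl | ha'
      · exact absurd (hu _ ha) (lt_irrefl _)
      · exact absurd ha' (h3 ha)
    obtain ⟨l₁, l₂, e, hl₁, hl₂⟩ := List.sublist_append_iff.1 hab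
    rcases l₁ with _ | ⟨x, _ | ⟨y, _ | ⟨z, l⟩⟩⟩
    · simp only [List.nil_append] at e
      subst e
      cases hl₂ with
      | cons _ h => exact h2 a b h
      | cons_cons _ h => exact hv b (h.subset (by simp))
    · simp only [List.cons_append, List.nil_append, List.cons.injEq] at e
      obtain ⟨rfl, rfl⟩ := e
      exact key (hl₁.subset (by simp)) (hl₂.subset (by simp))
    · simp only [List.cons_append, List.nil_append, List.cons.injEq] at e
      obtain ⟨rfl, rfl, rfl⟩ := e
      exact key (hl₁.subset (by simp)) (hl₂.subset (by simp))
    · simp only [List.cons_append, List.cons.injEq] at e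
      obtain ⟨rfl, rfl, rfl, e⟩ := e
      simp at e
      obtain ⟨rfl, rfl⟩ := e
      exact h1 _ _ hl₁

theorem nestedWord_intercalate {m : ℕ} {L : List (List ℕ)}
    (hlt : ∀ u ∈ L, ∀ x ∈ u, x < m) :
    NestedWord ([m].intercalate L) ↔ (∀ u ∈ L, NestedWord u) ∧ L.Pairwise List.Disjoint := by
  induction L with
  | nil => simp [NestedWord]
  | cons u L ih =>
    rcases L with _ | ⟨v, L⟩
    · simp
    · have hlt' : ∀ w ∈ v :: L, ∀ x ∈ w, x < m := fun w hw => hlt w (List.mem_cons_of_mem _ hw)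
      rw [List.intercalate_cons_cons, List.append_assoc, List.singleton_append,
        nestedWord_append_cons (hlt u (by simp)), ih hlt', List.pairwise_cons (a := u),
        List.forall_mem_cons (a := u)]
      · have : u.Disjoint ([m].intercalate (v :: L)) ↔ ∀ w ∈ v :: L, u.Disjoint w := by
          constructor
          · intro h w hw x hx hx'
            exact h hx (mem_intercalate_of_mem hw hx')
          · intro h x hx hx'
            rcases mem_intercalate_singleton hx' with rfl | ⟨w, hw, hx'⟩
            · exact lt_irrefl _ (hlt u (by simp) x hx)
            · exact h w hw hx hx'
        rw [this]
        tauto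
      · intro x hx
        rcases mem_intercalate_singleton hx with rfl | ⟨w, hw, hx⟩
        · exact le_rfl
        · exact (hlt' w hw x hx).le

theorem count_intercalate_of_ne {m x : ℕ} (h : x ≠ m) (L : List (List ℕ)) :
    ([m].intercalate L).count x = (L.map (List.count x)).sum := by
  induction L with
  | nil => simp
  | cons u L ih =>
    rcases L with _ | ⟨v, L⟩
    · simp
    · rw [List.intercalate_cons_cons, List.count_append, List.count_append, ih,
        List.count_singleton]
      simp [h.symm]

theorem count_intercalate_self {m : ℕ} {L : List (List ℕ)} (h : ∀ u ∈ L, m ∉ u) :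
    ([m].intercalate L).count m = L.length - 1 := by
  induction L with
  | nil => simp
  | cons u L ih =>
    rcases L with _ | ⟨v, L⟩
    · simpa using List.count_eq_zero_of_not_mem (h u (by simp))
    · rw [List.intercalate_cons_cons, List.count_append, List.count_append,
        ih fun w hw => h w (List.mem_cons_of_mem _ hw), List.count_eq_zero_of_not_mem (h u (by simp))]
      simp
      omega

theorem sum_count_eq_zero {L : List (List ℕ)} {x : ℕ} (h : ∀ u ∈ L, x ∉ u) :
    (L.map (List.count x)).sum = 0 := by
  rw [List.sum_eq_zero]
  intro k hk
  obtain ⟨u, hu, rfl⟩ := List.mem_map.1 hk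
  exact List.count_eq_zero_of_not_mem (h u hu)

theorem sum_count_of_pairwise_disjoint {L : List (List ℕ)} (hL : L.Pairwise List.Disjoint)
    {u : List ℕ} (hu : u ∈ L) {x : ℕ} (hx : x ∈ u) :
    (L.map (List.count x)).sum = u.count x := by
  induction L with
  | nil => simp at hu
  | cons v L ih =>
    rw [List.pairwise_cons] at hL
    rw [List.map_cons, List.sum_cons]
    rcases List.mem_cons.1 hu with rfl | hu
    · rw [sum_count_eq_zero fun w hw hxw => hL.1 w hw hx hxw, add_zero]
    · rw [ih hL.2 hu, List.count_eq_zero_of_not_mem fun h => hL.1 u hu h hx, zero_add]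

/-- A nested word in which every letter present occurs exactly `r` times. -/
structure RWord (r : ℕ) (w : List ℕ) : Prop where
  count_eq : ∀ x ∈ w, w.count x = r
  nested : NestedWord w

theorem rWord_nil (r : ℕ) : RWord r [] := ⟨by simp, by simp [NestedWord]⟩

/-- Disjointness puts all copies of a smaller letter in one block, and r + 1 blocks have r
separators m. -/
theorem rWord_intercalate {r m : ℕ} {L : List (List ℕ)} (hL : L.length = r + 1)
    (hlt : ∀ u ∈ L, ∀ x ∈ u, x < m) :
    RWord r ([m].intercalate L) ↔ (∀ u ∈ L, RWord r u) ∧ L.Pairwise List.Disjoint := by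
  have hcount : L.Pairwise List.Disjoint → ∀ u ∈ L, ∀ x ∈ u,
      ([m].intercalate L).count x = u.count x := fun h u hu x hx => by
    rw [count_intercalate_of_ne (hlt u hu x hx).ne, sum_count_of_pairwise_disjoint h hu hx]
  constructor
  · rintro ⟨h1, h2⟩
    rw [nestedWord_intercalate hlt] at h2
    refine ⟨fun u hu => ⟨fun x hx => ?_, h2.1 u hu⟩, h2.2⟩
    rw [← hcount h2.2 u hu x hx]
    exact h1 x (mem_intercalate_of_mem hu hx)
  · rintro ⟨h1, h2⟩
    refine ⟨fun x hx => ?_, (nestedWord_intercalate hlt).2 ⟨fun u hu => (h1 u hu).nested, h2⟩⟩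
    rcases mem_intercalate_singleton hx with rfl | ⟨u, hu, hx⟩
    · rw [count_intercalate_self fun u hu hxu => (hlt u hu x hxu).false, hL, Nat.add_sub_cancel]
    · rw [hcount h2 u hu x hx, (h1 u hu).count_eq x hx]

theorem not_mem_of_mem_splitOn {m : ℕ} {w u : List ℕ} (hu : u ∈ w.splitOn m) : m ∉ u := by
  induction hk : w.length using Nat.strong_induction_on generalizing w with
  | _ k ih =>
    subst hk
    by_cases hm : m ∈ w
    · obtain ⟨s, t, rfl⟩ := List.append_of_mem hm
      rw [List.splitOn_append_cons_self, List.mem_append] at hu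
      rcases hu with h | h
      · exact ih s.length (by simp) h rfl
      · exact ih t.length (by simp; omega) h rfl
    · rw [List.splitOn_eq_singleton hm, List.mem_singleton] at hu
      exact hu ▸ hm

theorem lt_max_of_mem_splitOn {w : List ℕ} (h : w ≠ []) {u : List ℕ}
    (hu : u ∈ w.splitOn (w.max h)) : ∀ x ∈ u, x < w.max h := by
  intro x hx
  have hxw : x ∈ w := by
    rw [← List.intercalate_splitOn (w.max h) (xs := w)]
    exact mem_intercalate_of_mem hu hx
  refine lt_of_le_of_ne (List.le_max_of_mem hxw) ?_
  rintro rfl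
  exact not_mem_of_mem_splitOn hu hx

theorem RWord.splitOn_max {r : ℕ} {w : List ℕ} (hw : RWord r w) (h : w ≠ []) :
    (w.splitOn (w.max h)).length = r + 1 ∧ (∀ u ∈ w.splitOn (w.max h), RWord r u) ∧
      (w.splitOn (w.max h)).Pairwise List.Disjoint := by
  have hlt : ∀ u ∈ w.splitOn (w.max h), ∀ x ∈ u, x < w.max h :=
    fun u hu => lt_max_of_mem_splitOn h hu
  have hlen : (w.splitOn (w.max h)).length = r + 1 := by
    have h1 := count_intercalate_self (m := w.max h) (L := w.splitOn (w.max h))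
      fun u hu => not_mem_of_mem_splitOn hu
    rw [List.intercalate_splitOn, hw.count_eq _ (List.max_mem h)] at h1
    have := List.length_pos_of_ne_nil (List.splitOn_ne_nil (w.max h) w)
    omega
  refine ⟨hlen, (rWord_intercalate hlen hlt).1 ?_⟩
  rwa [List.intercalate_splitOn]

theorem pairwise_disjoint_stackSort {L : List (List ℕ)} :
    L.Pairwise (Function.onFun List.Disjoint stackSort) ↔ L.Pairwise List.Disjoint := by
  have : Function.onFun List.Disjoint stackSort = List.Disjoint := by
    funext u v
    simp [Function.onFun, List.Disjoint, mem_stackSort]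
  rw [this]

/-- Different blocks share no letter and the copies of m are output once, so the second sorting acts
on a word with distinct letters. -/
theorem RWord.nodup_stackSort {r : ℕ} {w : List ℕ} (hw : RWord r w) : (stackSort w).Nodup := by
  induction hk : w.length using Nat.strong_induction_on generalizing w with
  | _ k ih =>
    subst hk
    by_cases h : w = []
    · simp [h]
    · obtain ⟨-, h2, h3⟩ := hw.splitOn_max h
      rw [stackSort_of_ne_nil h, ← List.concat_eq_append, List.nodup_concat, List.nodup_flatMap]
      refine ⟨?_, fun u hu => ih _ (length_lt_of_mem_splitOn (List.max_mem h) hu) (h2 u hu) rfl,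
        pairwise_disjoint_stackSort.2 h3⟩
      rw [List.mem_flatMap]
      rintro ⟨u, hu, hx⟩
      exact not_mem_of_mem_splitOn hu (mem_stackSort.1 hx)

/-- Separates the shape of a word from its letter set. As S preserves letter sets, the second
condition is automatic once S(S(w)) is the identity. -/
theorem isRPermutation_iff {r n : ℕ} (hr : 1 ≤ r) {w : List ℕ} :
    IsRPermutation r n w ↔ RWord r w ∧ ∀ x, x ∈ w ↔ x ∈ identityWord n := by
  have hmem : ∀ x, x ∈ identityWord n ↔ x ∈ Finset.Icc 1 n := by
    intro x
    simp [identityWord, List.mem_range'_1]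
    omega
  have hnest : (∀ i j k : Fin w.length, i < j → j < k → w[i] = w[k] → w[j] ≤ w[i]) ↔
      NestedWord w := by
    constructor
    · intro h a b hab
      obtain ⟨f, hf⟩ := List.sublist_iff_exists_fin_orderEmbedding_get_eq.1 hab
      have h0 := hf ⟨0, by simp⟩
      have h1 := hf ⟨1, by simp⟩
      have h2 := hf ⟨2, by simp⟩
      have := h (f ⟨0, by simp⟩) (f ⟨1, by simp⟩) (f ⟨2, by simp⟩)
        (f.strictMono (by simp)) (f.strictMono (by simp))
      simp at h0 h1 h2 this
      rw [← h0, ← h1, ← h2] at this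
      exact this rfl
    · intro h i j k hij hjk hik
      refine h w[i] w[j] ?_
      rw [List.sublist_iff_exists_fin_orderEmbedding_get_eq]
      refine ⟨OrderEmbedding.ofStrictMono ![i, j, k] ?_, ?_⟩
      · rw [Fin.strictMono_iff_lt_succ]
        intro a
        fin_cases a
        · exact hij
        · exact hjk
      · intro a
        fin_cases a
        · rfl
        · rfl
        · exact hik
  have hcoe : (w : Multiset ℕ) = r • (Finset.Icc 1 n).val ↔
      (∀ x ∈ w, w.count x = r) ∧ ∀ x, x ∈ w ↔ x ∈ identityWord n := by
    have hc : ∀ x, (r • (Finset.Icc 1 n).val).count x = if x ∈ identityWord n then r else 0 := by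
      intro x
      rw [Multiset.count_nsmul, Multiset.count_eq_of_nodup (Finset.Icc 1 n).nodup]
      simp only [Finset.mem_val, ← hmem]
      split_ifs <;> simp
    rw [Multiset.ext]
    simp only [hc, Multiset.coe_count]
    constructor
    · intro h
      have h' : ∀ x, x ∈ w ↔ x ∈ identityWord n := by
        intro x
        rw [← List.count_pos_iff, h x]
        split_ifs with hx <;> simp [hx]
        omega
      exact ⟨fun x hx => by rw [h, if_pos ((h' x).1 hx)], h'⟩
    · rintro ⟨h1, h2⟩ x
      split_ifs with hx
      · exact h1 x ((h2 x).2 hx)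
      · exact List.count_eq_zero_of_not_mem fun h => hx ((h2 x).1 h)
  constructor
  · rintro ⟨h1, h2⟩
    exact ⟨⟨(hcoe.1 h1).1, hnest.1 h2⟩, (hcoe.1 h1).2⟩
  · rintro ⟨⟨h1, h2⟩, h3⟩
    exact ⟨hcoe.2 ⟨h1, h3⟩, hnest.2 h2⟩

/-! ### Fibres of the stack-sorting operator -/

/-- Counting pairs whose labels concatenate to a given word is convolution. -/
theorem encard_wordConv {X Y : Type*} (A : List ℕ → Set X) (B : List ℕ → Set Y)
    (hA : ∀ σ τ x, x ∈ A σ → x ∈ A τ → σ = τ) (σ : List ℕ) :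
    {p : X × Y | ∃ τ τ', τ ++ τ' = σ ∧ p.1 ∈ A τ ∧ p.2 ∈ B τ'}.encard =
      wordConv (fun τ => (A τ).encard) (fun τ => (B τ).encard) σ := by
  induction σ generalizing A with
  | nil =>
    rw [wordConv, ← Set.encard_prod]
    congr 1
    ext p
    simp
  | cons x σ ih =>
    have h := ih (fun τ => A (x :: τ)) fun τ τ' y h h' => by simpa using hA _ _ y h h'
    rw [wordConv, ← Set.encard_prod, ← h, ← Set.encard_union_eq]
    · congr 1
      ext p
      constructor
      · rintro ⟨_ | ⟨y, τ⟩, τ', e, h1, h2⟩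
        · simp only [List.nil_append] at e
          subst e
          exact Or.inl ⟨h1, h2⟩
        · simp only [List.cons_append, List.cons.injEq] at e
          obtain ⟨rfl, e⟩ := e
          exact Or.inr ⟨τ, τ', e, h1, h2⟩
      · rintro (⟨h1, h2⟩ | ⟨τ, τ', e, h1, h2⟩)
        · exact ⟨[], x :: σ, rfl, h1, h2⟩
        · exact ⟨x :: τ, τ', by rw [← e]; rfl, h1, h2⟩
    · rw [Set.disjoint_left]
      rintro p ⟨h1, -⟩ ⟨τ, τ', -, h2, -⟩
      simpa using hA _ _ _ h1 h2

/-- The `r`-words that the stack-sorting operator sends to `σ`. -/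
def sortPreimage (r : ℕ) (σ : List ℕ) : Set (List ℕ) := {w | RWord r w ∧ stackSort w = σ}

/-- The number of nonempty `r`-words that the stack-sorting operator sends to `σ`. -/
noncomputable def treeCount (r : ℕ) (σ : List ℕ) : ℕ∞ :=
  if σ = [] then 0 else (sortPreimage r σ).encard

theorem sortPreimage_nil (r : ℕ) : sortPreimage r [] = {[]} := by
  ext w
  simp only [sortPreimage, Set.mem_ofPred_eq, stackSort_eq_nil, Set.mem_singleton_iff]
  exact ⟨fun h => h.2, by rintro rfl; exact ⟨rWord_nil r, rfl⟩⟩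

theorem encard_sortPreimage (r : ℕ) (σ : List ℕ) :
    (sortPreimage r σ).encard = wordPow (treeCount r) 0 σ + treeCount r σ := by
  by_cases h : σ = []
  · subst h
    simp [sortPreimage_nil, treeCount, wordPow]
  · simp [treeCount, wordPow, h]

/-- The `k`-tuples of `r`-words whose images under the stack-sorting operator concatenate
to `σ`. -/
def tuplePreimage (r k : ℕ) (σ : List ℕ) : Set (List (List ℕ)) :=
  {L | L.length = k ∧ (∀ u ∈ L, RWord r u) ∧ L.flatMap stackSort = σ}

theorem encard_tuplePreimage (r k : ℕ) (σ : List ℕ) : (tuplePreimage r k σ).encard =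
    ∑ i ∈ Finset.range (k + 1), (k.choose i : ℕ∞) * wordPow (treeCount r) i σ := by
  rw [← wordPow_one_add]
  induction k generalizing σ with
  | zero =>
    change _ = if σ = [] then 1 else 0
    by_cases h : σ = []
    · rw [if_pos h, show tuplePreimage r 0 σ = {[]} by
        ext L; simp +contextual [tuplePreimage, h], Set.encard_singleton]
    · rw [if_neg h, show tuplePreimage r 0 σ = ∅ by
        ext L
        simp only [tuplePreimage, List.length_eq_zero_iff, Set.mem_ofPred_eq,
          Set.mem_empty_iff_false, iff_false]
        rintro ⟨rfl, -, e⟩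
        exact h e.symm, Set.encard_empty]
  | succ k ih =>
    rw [wordPow_succ, wordConv_congr_right _ fun τ _ => (ih τ).symm]
    simp only [← encard_sortPreimage]
    rw [← encard_wordConv _ _ (fun σ τ x h h' => h.2.symm.trans h'.2)]
    rw [← Function.Injective.encard_image (f := fun p : List ℕ × List (List ℕ) => p.1 :: p.2)
      (fun p q h => by simpa [Prod.ext_iff] using h)]
    congr 1
    ext L
    constructor
    · rintro ⟨h1, h2, h3⟩
      rcases L with _ | ⟨u, L⟩
      · simp at h1
      · exact ⟨(u, L), ⟨stackSort u, L.flatMap stackSort, by simpa using h3, ⟨h2 u (by simp), rfl⟩,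
          ⟨by simpa using h1, fun v hv => h2 v (by simp [hv]), rfl⟩⟩, rfl⟩
    · rintro ⟨⟨u, L⟩, ⟨τ, τ', e, ⟨h1, h2⟩, h3, h4, h5⟩, rfl⟩
      refine ⟨by simpa using h3, ?_, by simp [← e, ← h2, ← h5]⟩
      simpa using ⟨h1, h4⟩

/-- Cutting at m identifies the trees over τ m with (r + 1)-tuples of possibly empty r-words over τ;
the index i is the number of nonempty ones. -/
theorem treeCount_concat {r m : ℕ} (hr : 1 ≤ r) {τ : List ℕ} (hτ : τ.Nodup)
    (hlt : ∀ x ∈ τ, x < m) : treeCount r (τ ++ [m]) =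
      ∑ i ∈ Finset.range (r + 2), ((r + 1).choose i : ℕ∞) * wordPow (treeCount r) i τ := by
  rw [← encard_tuplePreimage, treeCount, if_neg (by simp)]
  have hltL : ∀ L ∈ tuplePreimage r (r + 1) τ, ∀ u ∈ L, ∀ x ∈ u, x < m := by
    rintro L ⟨-, -, h⟩ u hu x hx
    refine hlt x ?_
    rw [← h]
    exact List.mem_flatMap.2 ⟨u, hu, mem_stackSort.2 hx⟩
  have hinj : Set.InjOn (fun L => [m].intercalate L) (tuplePreimage r (r + 1) τ) := by
    have : ∀ L ∈ tuplePreimage r (r + 1) τ, ([m].intercalate L).splitOn m = L := by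
      intro L hL
      refine List.splitOn_intercalate m (fun u hu hx => (hltL L hL u hu m hx).false) ?_
      rintro rfl
      simpa using hL.1
    intro L hL L' hL' h
    rw [← this L hL, ← this L' hL']
    exact congrArg _ h
  rw [← hinj.encard_image]
  congr 1
  ext w
  constructor
  · rintro ⟨h1, h2⟩
    have h : w ≠ [] := by rintro rfl; simp at h2
    rw [stackSort_of_ne_nil h] at h2
    obtain ⟨h3, h4⟩ := List.append_inj' h2 rfl
    rw [List.singleton_inj] at h4
    obtain ⟨h5, h6, -⟩ := h1.splitOn_max h
    rw [h4] at h5 h6 h3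
    exact ⟨w.splitOn m, ⟨h5, h6, h3⟩, List.intercalate_splitOn m⟩
  · rintro ⟨L, hL, rfl⟩
    have h := hL
    obtain ⟨h1, h2, h3⟩ := h
    refine ⟨(rWord_intercalate h1 (hltL L hL)).2 ⟨h2, ?_⟩, ?_⟩
    -- Disjointness is not part of `tuplePreimage`; it follows from τ having no repeated letter.
    · rw [← h3, List.nodup_flatMap] at hτ
      exact pairwise_disjoint_stackSort.1 hτ.2
    · change stackSort ([m].intercalate L) = _
      rw [stackSort_intercalate (by omega) (hltL L hL), h3]

/-- The image of a nonempty word ends in its largest letter. -/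
theorem treeCount_eq_zero (r : ℕ) {m : ℕ} {α τ : List ℕ} (h : τ ≠ []) (hτ : ∀ x ∈ τ, x < m) :
    treeCount r (α ++ m :: τ) = 0 := by
  rw [treeCount, if_neg (by simp), Set.encard_eq_zero, Set.eq_empty_iff_forall_notMem]
  rintro w ⟨-, h2⟩
  have hw : w ≠ [] := by rintro rfl; simp at h2
  have hm : m ∈ w := by rw [← mem_stackSort, h2]; simp
  obtain ⟨τ', x, rfl⟩ := List.eq_nil_or_concat' τ |>.resolve_left h
  rw [stackSort_of_ne_nil hw, ← List.cons_append, ← List.append_assoc] at h2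
  have h4 := List.singleton_inj.1 (List.append_inj' h2 rfl).2
  have := List.le_max_of_mem hm
  have := hτ x (by simp)
  omega

/-! ### Sortable words cut at their largest letter -/

/-- The words without repetition that the stack-sorting operator sends to
`a (a + 1) ⋯ (a + n - 1)`. -/
def sortableWords (a n : ℕ) : Finset (List ℕ) :=
  ((List.range' a n).permutations.toFinset).filter fun σ => stackSort σ = List.range' a n

theorem mem_sortableWords {a n : ℕ} {σ : List ℕ} :
    σ ∈ sortableWords a n ↔ σ.Nodup ∧ stackSort σ = List.range' a n := by
  rw [sortableWords, Finset.mem_filter, List.mem_toFinset, List.mem_permutations]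
  refine and_congr_left fun h => ⟨fun h' => h'.nodup_iff.2 List.nodup_range', fun h' => ?_⟩
  rw [List.perm_ext_iff_of_nodup h' List.nodup_range']
  intro x
  rw [← h, mem_stackSort]

theorem mem_of_mem_sortableWords {a n : ℕ} {σ : List ℕ} (h : σ ∈ sortableWords a n) (x : ℕ) :
    x ∈ σ ↔ a ≤ x ∧ x < a + n := by
  rw [← mem_stackSort, (mem_sortableWords.1 h).2, List.mem_range'_1]

theorem length_of_mem_sortableWords {a n : ℕ} {σ : List ℕ} (h : σ ∈ sortableWords a n) :
    σ.length = n := by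
  rw [sortableWords, Finset.mem_filter, List.mem_toFinset, List.mem_permutations] at h
  simpa using h.1.length_eq

theorem stackSort_append_cons {m : ℕ} {α β : List ℕ} (hα : ∀ x ∈ α, x < m)
    (hβ : ∀ x ∈ β, x < m) : stackSort (α ++ m :: β) = stackSort α ++ stackSort β ++ [m] := by
  have := stackSort_intercalate (m := m) (L := [α, β]) (by simp) (by simpa using ⟨hα, hβ⟩)
  simpa [List.intercalate_cons_cons] using this

theorem append_cons_mem_sortableWords {a n : ℕ} {α β : List ℕ} {p : ℕ × ℕ} (hp : p.1 + p.2 = n)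
    (hα : α ∈ sortableWords a p.1) (hβ : β ∈ sortableWords (a + p.1) p.2) :
    α ++ (a + n) :: β ∈ sortableWords a (n + 1) := by
  have hα' := mem_of_mem_sortableWords hα
  have hβ' := mem_of_mem_sortableWords hβ
  rw [mem_sortableWords] at hα hβ ⊢
  constructor
  · rw [List.nodup_append, List.nodup_cons]
    refine ⟨hα.1, ⟨?_, hβ.1⟩, ?_⟩
    · rw [hβ']; omega
    · intro x hx y hy
      rw [hα'] at hx
      rcases List.mem_cons.1 hy with rfl | hy
      · omega
      · rw [hβ'] at hy; omega
  · rw [stackSort_append_cons (fun x hx => by rw [hα'] at hx; omega)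
      (fun x hx => by rw [hβ'] at hx; omega), hα.2, hβ.2, List.range'_append_1, hp,
      List.range'_1_concat]

theorem exists_of_mem_sortableWords {a n : ℕ} {σ : List ℕ} (h : σ ∈ sortableWords a (n + 1)) :
    ∃ (p : ℕ × ℕ) (α β : List ℕ), p.1 + p.2 = n ∧ α ∈ sortableWords a p.1 ∧ β ∈ sortableWords (a + p.1) p.2 ∧
      α ++ (a + n) :: β = σ := by
  have hm := mem_of_mem_sortableWords h
  obtain ⟨α, β, rfl⟩ := List.append_of_mem ((hm (a + n)).2 (by omega))
  rw [mem_sortableWords] at h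
  obtain ⟨h1, h2⟩ := h
  rw [List.nodup_append, List.nodup_cons] at h1
  obtain ⟨hα, ⟨hβm, hβ⟩, hαβ⟩ := h1
  have hα' : ∀ x ∈ α, x < a + n := fun x hx => by
    have := (hm x).1 (by simp [hx])
    have := hαβ x hx (a + n) (by simp)
    omega
  have hβ' : ∀ x ∈ β, x < a + n := fun x hx => by
    have := (hm x).1 (by simp [hx])
    have : x ≠ a + n := by rintro rfl; exact hβm hx
    omega
  rw [stackSort_append_cons hα' hβ', List.range'_1_concat] at h2
  have h3 := (List.append_inj' h2 rfl).1
  have hlen : (stackSort α).length + (stackSort β).length = n := by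
    simpa using congrArg List.length h3
  -- Since S(α) S(β) is an interval in increasing order, its two pieces are consecutive intervals;
  -- hence the shifted start of β.
  have h4 : List.range' a n = List.range' a (stackSort α).length ++
      List.range' (a + (stackSort α).length) (stackSort β).length := by
    rw [List.range'_append_1, hlen]
  rw [h4] at h3
  obtain ⟨h5, h6⟩ := List.append_inj h3 (by simp)
  exact ⟨((stackSort α).length, (stackSort β).length), α, β, hlen, mem_sortableWords.2 ⟨hα, h5⟩,
    mem_sortableWords.2 ⟨hβ, h6⟩, rfl⟩

theorem append_cons_injective {m : ℕ} {α β α' β' : List ℕ} (hα : m ∉ α) (hα' : m ∉ α')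
    (h : α ++ m :: β = α' ++ m :: β') : α = α' ∧ β = β' := by
  induction α generalizing α' with
  | nil =>
    cases α' with
    | nil => simpa using h
    | cons x α' => simp at h hα'; exact absurd h.1 hα'.1
  | cons y α ih =>
    cases α' with
    | nil => simp at h hα; exact absurd h.1.symm hα.1
    | cons x α' =>
      simp only [List.cons_append, List.cons.injEq, List.mem_cons, not_or] at h hα hα' ⊢
      have := ih hα.2 hα'.2 h.2
      exact ⟨⟨h.1, this.1⟩, this.2⟩

theorem sum_sortableWords_succ {K : Type*} [AddCommMonoid K] (g : List ℕ → K) (a n : ℕ) :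
    ∑ σ ∈ sortableWords a (n + 1), g σ = ∑ p ∈ Finset.HasAntidiagonal.antidiagonal n,
      ∑ α ∈ sortableWords a p.1, ∑ β ∈ sortableWords (a + p.1) p.2, g (α ++ (a + n) :: β) := by
  simp only [← Finset.sum_product']
  rw [Finset.sum_sigma']
  symm
  refine Finset.sum_nbij (fun x => x.2.1 ++ (a + n) :: x.2.2) ?_ ?_ ?_ fun _ _ => rfl
  · rintro ⟨p, α, β⟩ h
    simp only [Finset.mem_sigma, Finset.mem_product,
      Finset.HasAntidiagonal.mem_antidiagonal] at h
    exact append_cons_mem_sortableWords h.1 h.2.1 h.2.2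
  · rintro ⟨⟨i, k⟩, α, β⟩ h ⟨⟨i', k'⟩, α', β'⟩ h' e
    simp only [Finset.coe_sigma, Set.mem_sigma_iff, Finset.mem_coe, Finset.mem_product,
      Finset.HasAntidiagonal.mem_antidiagonal] at h h' e
    obtain ⟨rfl, rfl⟩ := append_cons_injective
      (fun hx => by have := (mem_of_mem_sortableWords h.2.1 _).1 hx; omega)
      (fun hx => by have := (mem_of_mem_sortableWords h'.2.1 _).1 hx; omega) e
    obtain rfl : i = i' :=
      (length_of_mem_sortableWords h.2.1).symm.trans (length_of_mem_sortableWords h'.2.1)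
    obtain rfl : k = k' :=
      (length_of_mem_sortableWords h.2.2).symm.trans (length_of_mem_sortableWords h'.2.2)
    rfl
  · intro σ hσ
    obtain ⟨p, α, β, hp, hα, hβ, e⟩ := exists_of_mem_sortableWords hσ
    refine ⟨⟨p, α, β⟩, ?_, e⟩
    simp only [Finset.coe_sigma, Set.mem_sigma_iff, Finset.mem_coe, Finset.mem_product,
      Finset.HasAntidiagonal.mem_antidiagonal]
    exact ⟨hp, hα, hβ⟩

/-! ### Assembling the count -/

theorem sum_wordPow_treeCount {r : ℕ} (hr : 1 ≤ r) (n a j : ℕ) :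
    ∑ σ ∈ sortableWords a n, wordPow (treeCount r) j σ = (forestCount r n j : ℕ∞) := by
  induction n using Nat.strong_induction_on generalizing a j with
  | _ n ih =>
    rcases n with _ | n
    · have : sortableWords a 0 = {[]} := by
        ext σ
        simp only [mem_sortableWords, List.range'_zero, stackSort_eq_nil, Finset.mem_singleton]
        exact ⟨fun h => h.2, by rintro rfl; simp⟩
      rw [this, Finset.sum_singleton, forestCount]
      cases j with
      | zero => simp [wordPow]
      | succ j => simp [wordPow, wordConv, treeCount]
    · rw [sum_sortableWords_succ]
      rcases j with _ | j
      · simp [wordPow, forestCount]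
      · rw [forestCount_succ_succ]
        push_cast
        refine Finset.sum_congr rfl fun p hp => ?_
        rw [Finset.HasAntidiagonal.mem_antidiagonal] at hp
        have h1 : ∀ α ∈ sortableWords a p.1, ∀ β ∈ sortableWords (a + p.1) p.2,
            wordPow (treeCount r) (j + 1) (α ++ (a + n) :: β) =
            ∑ q ∈ Finset.HasAntidiagonal.antidiagonal j,
              (∑ l ∈ Finset.range (r + 2), ((r + 1).choose l : ℕ∞) *
                wordPow (treeCount r) (q.1 + l) α) * wordPow (treeCount r) q.2 β := by
          intro α hα β hβ
          rw [wordPow_append_cons]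
          · refine Finset.sum_congr rfl fun q _ => ?_
            congr 1
            rw [wordConv_congr_right _ fun τ hτ => treeCount_concat hr
              ((mem_sortableWords.1 hα).1.sublist hτ.sublist) fun x hx => by
                have := (mem_of_mem_sortableWords hα x).1 (hτ.subset hx); omega,
              wordConv_sum_right]
            simp only [wordConv_mul_right, wordPow_add]
          · intro α' τ hτ hτβ
            refine treeCount_eq_zero r hτ fun x hx => ?_
            have := (mem_of_mem_sortableWords hβ x).1 (hτβ.subset hx)
            omega
        rw [Finset.sum_congr rfl fun α hα => Finset.sum_congr rfl fun β hβ => h1 α hα β hβ]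
        rw [Finset.sum_congr rfl fun α _ => Finset.sum_comm, Finset.sum_comm]
        refine Finset.sum_congr rfl fun q _ => ?_
        rw [← Finset.sum_mul_sum, Finset.sum_comm, ih p.2 (by omega)]
        congr 1
        refine Finset.sum_congr rfl fun l _ => ?_
        rw [← Finset.mul_sum, ih p.1 (by omega)]

/-- The fibres of S over distinct σ are disjoint, and a fibre over a nonempty σ is the case of one
tree. Counting in `ℕ∞` makes finiteness a consequence. -/
theorem encard_isTwoStackSortable {r n : ℕ} (hr : 1 ≤ r) (hn : 1 ≤ n) :
    {w : List ℕ | IsTwoStackSortable r n w}.encard = (forestCount r n 1 : ℕ∞) := by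
  have h1 : {w : List ℕ | IsTwoStackSortable r n w} =
      ⋃ σ ∈ sortableWords 1 n, sortPreimage r σ := by
    ext w
    simp only [Set.mem_ofPred_eq, Set.mem_iUnion, IsTwoStackSortable, isRPermutation_iff hr,
      exists_prop, mem_sortableWords, sortPreimage]
    constructor
    · rintro ⟨⟨h1, -⟩, h2⟩
      exact ⟨_, ⟨h1.nodup_stackSort, h2⟩, h1, rfl⟩
    · rintro ⟨σ, ⟨-, h2⟩, h3, rfl⟩
      refine ⟨⟨h3, fun x => ?_⟩, h2⟩
      rw [identityWord, ← h2, mem_stackSort, mem_stackSort]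
  rw [h1, ← sum_wordPow_treeCount hr n 1 1]
  refine ((sortableWords 1 n).finite_toSet.encard_biUnion ?_).trans ?_
  rotate_left
  · rw [finsum_mem_coe_finset]
    refine Finset.sum_congr rfl fun σ hσ => ?_
    rw [wordPow_one, treeCount, if_neg]
    rintro rfl
    have := length_of_mem_sortableWords hσ
    simp at this
    omega
  · intro σ _ τ _ hne
    rw [Function.onFun, Set.disjoint_left]
    intro w h h'
    exact hne (h.2.symm.trans h'.2)

theorem isTwoStackSortable_one_iff {n : ℕ} {w : List ℕ} : IsTwoStackSortable 1 n w ↔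
    w.Perm (identityWord n) ∧ stackSort (stackSort w) = identityWord n := by
  refine and_congr_left fun _ => ?_
  rw [isRPermutation_iff le_rfl]
  have hid : (identityWord n).Nodup := List.nodup_range'
  constructor
  · rintro ⟨h1, h2⟩
    refine (List.perm_ext_iff_of_nodup (List.nodup_iff_count_le_one.2 fun x => ?_) hid).2 h2
    by_cases hx : x ∈ w
    · exact (h1.count_eq x hx).le
    · simp [List.count_eq_zero_of_not_mem hx]
  · intro h
    have hw : w.Nodup := h.nodup_iff.2 hid
    refine ⟨⟨fun x hx => List.count_eq_one_of_mem hw hx, fun a b hab => ?_⟩, fun x => h.mem_iff⟩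
    simpa using hab.nodup hw

theorem mainTheorem2 (n : ℕ) (hn : 1 ≤ n) :
    (∀ r : ℕ, 1 ≤ r →
      (({w : List ℕ | IsTwoStackSortable r n w}.ncard : ℕ) : ℚ) =
        2 * ((r : ℚ) + 1) * (((2 * r + 1) * n).factorial : ℚ) /
          ((n.factorial : ℚ) * ((2 * r * n + 2).factorial : ℚ))) ∧
    (({w : List ℕ | w.Perm (identityWord n) ∧
          stackSort (stackSort w) = identityWord n}.ncard : ℕ) : ℚ) =
      2 * ((3 * n).factorial : ℚ) /
        (((n + 1).factorial : ℚ) * ((2 * n + 1).factorial : ℚ)) := by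
  have key : ∀ r : ℕ, 1 ≤ r →
      (({w : List ℕ | IsTwoStackSortable r n w}.ncard : ℕ) : ℚ) =
        2 * ((r : ℚ) + 1) * (((2 * r + 1) * n).factorial : ℚ) /
          ((n.factorial : ℚ) * ((2 * r * n + 2).factorial : ℚ)) := by
    intro r hr
    rw [← forestCount_one r n hn, Set.ncard, encard_isTwoStackSortable hr hn, ENat.toNat_natCast]
  refine ⟨key, ?_⟩
  have h := key 1 le_rfl
  simp only [isTwoStackSortable_one_iff] at h
  rw [h, show (2 * 1 + 1) * n = 3 * n by ring, show 2 * 1 * n + 2 = 2 * n + 1 + 1 by ring,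
    Nat.factorial_succ n, Nat.factorial_succ (2 * n + 1)]
  push_cast
  field_simp
  ring
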